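/- Let $(M^{m+d},g)$ be a compact connected smooth Riemannian manifold (without boundary), let $H\subset TM$ be a smooth subbundle of rank $m$ with $g$-orthogonal projection $\pi_H:TM\to H$ (so that $(M,H,g|_H)$ is a sub-Riemannian manifold), and let $(N^n,h)$ be a smooth Riemannian manifold with Levi-Civita connection $\tilde\nabla$ and curvature tensor $\tilde R(X,Y)=[\tilde\nabla_X,\tilde\nabla_Y]-\tilde\nabla_{[X,Y]}$. For a smooth map $f:M\to N$ put $df_H=df\circ\pi_H$ and $$E(f)=\int_M e^{|df_H|^2/2}\,dv_g ,$$ where $|df_H|$ is the Hilbert-Schmidt norm and $dv_g$ the Riemannian volume of $g$. A smooth map $f$ is called exponentially subelliptic harmonic if it is a critical point of $E$, that is, $\frac{d}{dt}E(f_t)|_{t=0}=0$ for every smooth one-parameter family $(f_t)_{|t|<\epsilon}$ of maps $M\to N$ with $f_0=f$ whose variation field $\frac{\partial f_t}{\partial t}|_{t=0}$ has compact support. For a smooth vector field $V$ along $f$ (a smooth section of $f^{-1}TN$) put $$I_H(V,V)=\int_M e^{|df_H|^2/2}\Big[\Big(\sum_{i=1}^m\langle\tilde\nabla_{e_i}V,df(e_i)\rangle\Big)^2+\sum_{i=1}^m\langle\tilde\nabla_{e_i}V,\tilde\nabla_{e_i}V\rangle-\sum_{i=1}^m\langle\tilde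 R(df(e_i),V)V,df(e_i)\rangle\Big]dv_g ,$$ where $e_1,\dots,e_m$ is, at each point, an orthonormal basis of $H$ and $\tilde\nabla$ also denotes the connection induced on $f^{-1}TN$. The map $f$ is called stable if $I_H(V,V)\ge 0$ for every compactly supported smooth vector field $V$ along $f$. If all sectional curvatures of $N$ are nonpositive, then every exponentially subelliptic harmonic map $f:M\to N$ is stable. -/

import Mathlib

open Bundle MeasureTheory
open scoped Manifold ContDiff

noncomputable section

namespace ExpSubelliptic

/-! ### Local coordinates, Christoffel symbols and curvature of a Riemannian manifold -/

section Coordinates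

variable {n : ℕ} {N : Type*} [TopologicalSpace N] [ChartedSpace (EuclideanSpace ℝ (Fin n)) N]

/-- The components at `q` of a tangent vector `v` in the chart `φ` around `p`, that is,
`dφ_q (v)`. -/
def components (p : N) {q : N} (v : TangentSpace (𝓡 n) q) : EuclideanSpace ℝ (Fin n) :=
  mvfderiv (𝓡 n) (extChartAt (𝓡 n) p) q v

/-- The coordinate vector field `∂_i` of the chart `φ` around `p`, at the point `q` of its domain,
that is, `(dφ_q)⁻¹ (e_i)`. -/
def coordField (p q : N) (i : Fin n) : TangentSpace (𝓡 n) q :=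
  (mvfderiv (𝓡 n) (extChartAt (𝓡 n) p) q).inverse (EuclideanSpace.single i 1)

/-- The partial derivative `∂_i F` of a real function on the coordinate space. -/
def partialDeriv (i : Fin n) (F : EuclideanSpace ℝ (Fin n) → ℝ) (z : EuclideanSpace ℝ (Fin n)) :
    ℝ :=
  fderiv ℝ F z (EuclideanSpace.single i 1)

variable [RiemannianBundle (fun y : N ↦ TangentSpace (𝓡 n) y)]

/-- The matrix `g_{ij} = ⟨∂_i, ∂_j⟩` of the metric in the chart around `p`, as a function of the
coordinates `z`. -/
def metricMatrix (p : N) (z : EuclideanSpace ℝ (Fin n)) : Matrix (Fin n) (Fin n) ℝ :=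
  Matrix.of fun i j ↦
    inner ℝ (coordField p ((extChartAt (𝓡 n) p).symm z) i)
      (coordField p ((extChartAt (𝓡 n) p).symm z) j)

/-- The Christoffel symbols of the Levi-Civita connection in the chart around `p`,
`Γ^k_{ij} = ½ ∑_l g^{kl} (∂_i g_{jl} + ∂_j g_{il} - ∂_l g_{ij})`,
so that `∇_{∂_i} ∂_j = ∑_k Γ^k_{ij} ∂_k`. -/
def christoffel (p : N) (k i j : Fin n) (z : EuclideanSpace ℝ (Fin n)) : ℝ :=
  (1 / 2) * ∑ l, (metricMatrix p z)⁻¹ k l *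
    (partialDeriv i (fun w ↦ metricMatrix p w j l) z
      + partialDeriv j (fun w ↦ metricMatrix p w i l) z
      - partialDeriv l (fun w ↦ metricMatrix p w i j) z)

/-- The coefficients of the curvature tensor `R(X,Y) = [∇_X, ∇_Y] - ∇_{[X,Y]}` in the chart
around `p`: `R(∂_i, ∂_j) ∂_k = ∑_l R^l_{kij} ∂_l`. -/
def curvatureCoeff (p : N) (l k i j : Fin n) (z : EuclideanSpace ℝ (Fin n)) : ℝ :=
  partialDeriv i (christoffel p l j k) z - partialDeriv j (christoffel p l i k) z
    + ∑ s, (christoffel p l i s z * christoffel p s j k z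
      - christoffel p l j s z * christoffel p s i k z)

/-- The Riemann curvature tensor `R(u, v) w` at the point `y`. -/
def curvature {y : N} (u v w : TangentSpace (𝓡 n) y) : TangentSpace (𝓡 n) y :=
  ∑ l, (∑ i, ∑ j, ∑ k, curvatureCoeff y l k i j (extChartAt (𝓡 n) y y) *
    components y u i * components y v j * components y w k) • coordField y y l

/-- The sectional curvature of the plane spanned by `u` and `v`. -/
def sectionalCurvature {y : N} (u v : TangentSpace (𝓡 n) y) : ℝ :=
  inner ℝ (curvature u v v) u / (‖u‖ ^ 2 * ‖v‖ ^ 2 - (inner ℝ u v) ^ 2)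

variable (n N) in
/-- All sectional curvatures are nonpositive. -/
def HasNonposCurvature : Prop :=
  ∀ (y : N) (u v : TangentSpace (𝓡 n) y), LinearIndependent ℝ ![u, v] →
    sectionalCurvature u v ≤ 0

/-- The Riemannian volume of the chart domain around `p`: the measure `√(det g_{ij}) dz`,
transported from the chart's image to the manifold. -/
def chartVolume [MeasurableSpace N] (p : N) : Measure N :=
  (((volume : Measure (EuclideanSpace ℝ (Fin n))).restrict
    (extChartAt (𝓡 n) p).target).withDensity
      (fun z ↦ ENNReal.ofReal (Real.sqrt (metricMatrix p z).det))).map (extChartAt (𝓡 n) p).symm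

variable (n N) in
/-- The Riemannian volume measure. The chart volumes agree on overlaps, so each is the restriction
of the Riemannian volume to a chart domain; the Riemannian volume is the supremum, in the lattice
of measures, of these restrictions. -/
def riemannianVolume [MeasurableSpace N] : Measure N :=
  ⨆ p : N, chartVolume (n := n) p

end Coordinates

/-! ### Sub-Riemannian manifolds and maps from them -/

/-- A smooth rank-`m` subbundle of the tangent bundle of a `k`-dimensional manifold. -/
structure Subbundle (k : ℕ) (M : Type*) [TopologicalSpace M]
    [ChartedSpace (EuclideanSpace ℝ (Fin k)) M] [IsManifold (𝓡 k) ∞ M] (m : ℕ) where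
  /-- The fiber over a point. -/
  fiber : (x : M) → Submodule ℝ (TangentSpace (𝓡 k) x)
  /-- Near each point the fibers have a smooth frame of `m` vector fields. -/
  exists_frame : ∀ x₀ : M, ∃ U : Set M, IsOpen U ∧ x₀ ∈ U ∧
    ∃ X : Fin m → (x : M) → TangentSpace (𝓡 k) x,
      (∀ i, ContMDiffOn (𝓡 k) (𝓡 k).tangent ∞
        (fun x ↦ (⟨x, X i x⟩ : TangentBundle (𝓡 k) M)) U) ∧
      ∀ x ∈ U, LinearIndependent ℝ (fun i ↦ X i x) ∧
        Submodule.span ℝ (Set.range fun i ↦ X i x) = fiber x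

section Maps

variable {k m n : ℕ}
  {M : Type*} [TopologicalSpace M] [ChartedSpace (EuclideanSpace ℝ (Fin k)) M]
  [IsManifold (𝓡 k) ∞ M] [RiemannianBundle (fun x : M ↦ TangentSpace (𝓡 k) x)]
  {N : Type*} [TopologicalSpace N] [ChartedSpace (EuclideanSpace ℝ (Fin n)) N]
  [IsManifold (𝓡 n) ∞ N] [RiemannianBundle (fun y : N ↦ TangentSpace (𝓡 n) y)]

instance (x : M) : FiniteDimensional ℝ (TangentSpace (𝓡 k) x) :=
  inferInstanceAs (FiniteDimensional ℝ (EuclideanSpace ℝ (Fin k)))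

/-- `df_H = df ∘ π_H` at `x`, where `π_H` is the orthogonal projection onto `H`. -/
def horizontalDeriv (H : Subbundle k M m) (f : M → N) (x : M) :
    TangentSpace (𝓡 k) x →L[ℝ] TangentSpace (𝓡 n) (f x) :=
  (mfderiv (𝓡 k) (𝓡 n) f x).comp (H.fiber x).starProjection

/-- `|df_H|²` at `x`, the squared Hilbert-Schmidt norm. -/
def horizontalNormSq (H : Subbundle k M m) (f : M → N) (x : M) : ℝ :=
  ∑ A, ‖horizontalDeriv (n := n) H f x (stdOrthonormalBasis ℝ (TangentSpace (𝓡 k) x) A)‖ ^ 2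

/-- The horizontal exponential energy `E(f) = ∫_M exp(|df_H|²/2) dv_g`. -/
def energy [MeasurableSpace M] (H : Subbundle k M m) (f : M → N) : ℝ :=
  ∫ x, Real.exp (horizontalNormSq (n := n) H f x / 2) ∂(riemannianVolume k M)

/-- `V` is a smooth vector field along `f`, i.e. a smooth section of `f⁻¹TN`. -/
def IsSmoothAlong (f : M → N) (V : (x : M) → TangentSpace (𝓡 n) (f x)) : Prop :=
  ContMDiff (𝓡 k) (𝓡 n).tangent ∞ (fun x ↦ (⟨f x, V x⟩ : TangentBundle (𝓡 n) N))

/-- `V` has compact support. -/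
def HasCompactSupportAlong (f : M → N) (V : (x : M) → TangentSpace (𝓡 n) (f x)) : Prop :=
  IsCompact (closure {x | V x ≠ 0})

/-- `f` is an exponentially subelliptic harmonic map: it is smooth, and a critical point of `E`
with respect to all smooth variations `(f_t)_{|t| < ε}` whose variation field
`∂f_t/∂t|_{t=0}` has compact support. -/
def IsExpSubellipticHarmonic [MeasurableSpace M] (H : Subbundle k M m) (f : M → N) : Prop :=
  ContMDiff (𝓡 k) (𝓡 n) ∞ f ∧
  ∀ (ε : ℝ) (F : ℝ → M → N), 0 < ε →
    ContMDiffOn (𝓘(ℝ, ℝ).prod (𝓡 k)) (𝓡 n) ∞ (fun q : ℝ × M ↦ F q.1 q.2)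
      (Set.Ioo (-ε) ε ×ˢ Set.univ) →
    F 0 = f →
    HasCompactSupportAlong (F 0)
      (fun x ↦ mfderiv 𝓘(ℝ, ℝ) (𝓡 n) (fun t : ℝ ↦ F t x) 0 (1 : ℝ)) →
    HasDerivAt (fun t ↦ energy (n := n) H (F t)) 0 0

/-- The pull-back to `f⁻¹TN` of the Levi-Civita connection of `N`, applied to `V` in the
direction `v`. In a chart around `f x`, with `V = ∑_k V^k ∂_k`, it is
`∇^f_v V = ∑_k (dV^k(v) + ∑_{i,j} Γ^k_{ij}(f x) df(v)^i V^j) ∂_k`. -/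
def pullbackCov (f : M → N) (V : (x : M) → TangentSpace (𝓡 n) (f x)) (x : M)
    (v : TangentSpace (𝓡 k) x) : TangentSpace (𝓡 n) (f x) :=
  ∑ l, (mvfderiv (𝓡 k) (fun x' : M ↦ components (f x) (V x') l) x v
    + ∑ i, ∑ j, christoffel (f x) l i j (extChartAt (𝓡 n) (f x) (f x)) *
        components (f x) (mfderiv (𝓡 k) (𝓡 n) f x v) i * components (f x) (V x) j) •
    coordField (f x) (f x) l

/-- The integrand of the index form without its exponential weight, for the orthonormal basis
`(e_i)` of `H` at `x`:
`(∑_i ⟨∇_{e_i} V, df(e_i)⟩)² + ∑_i |∇_{e_i} V|² - ∑_i ⟨R(df(e_i), V) V, df(e_i)⟩`. -/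
def indexDensity (H : Subbundle k M m) (f : M → N) (V : (x : M) → TangentSpace (𝓡 n) (f x))
    (x : M) : ℝ :=
  let e := fun i ↦ ((stdOrthonormalBasis ℝ (H.fiber x) i : H.fiber x) : TangentSpace (𝓡 k) x)
  let df := mfderiv (𝓡 k) (𝓡 n) f x
  (∑ i, inner ℝ (pullbackCov f V x (e i)) (df (e i))) ^ 2
    + ∑ i, inner ℝ (pullbackCov f V x (e i)) (pullbackCov f V x (e i))
    - ∑ i, inner ℝ (curvature (df (e i)) (V x) (V x)) (df (e i))

/-- The index form `I_H(V, V)`. -/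
def indexForm [MeasurableSpace M] (H : Subbundle k M m) (f : M → N)
    (V : (x : M) → TangentSpace (𝓡 n) (f x)) : ℝ :=
  ∫ x, Real.exp (horizontalNormSq (n := n) H f x / 2) * indexDensity H f V x ∂(riemannianVolume k M)

/-- `f` is stable: `I_H(V, V) ≥ 0` for every compactly supported smooth vector field `V`
along `f`. -/
def IsStable [MeasurableSpace M] (H : Subbundle k M m) (f : M → N) : Prop :=
  ∀ V : (x : M) → TangentSpace (𝓡 n) (f x),
    IsSmoothAlong (k := k) f V → HasCompactSupportAlong f V → 0 ≤ indexForm H f V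

end Maps

end ExpSubelliptic

end

namespace ExpSubelliptic

section Curvature

variable {n : ℕ} {N : Type*} [TopologicalSpace N] [ChartedSpace (EuclideanSpace ℝ (Fin n)) N]
  [RiemannianBundle (fun y : N ↦ TangentSpace (𝓡 n) y)]

/-! The integrand of the index form is nonnegative at every point: the weight is positive, the first
two terms are a square and a sum of squared norms, and each curvature term `⟨R(df e_i, V) V, df
e_i⟩` is nonpositive. Only the last claim needs work, because sectional curvature controls
independent pairs only, while `df e_i` and `V` may be dependent.
`HasNonposCurvature.inner_curvature_nonpos` covers both cases: for an independent pair the Gram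
determinant is positive, so the numerator has the sign of the quotient; for a dependent pair
antisymmetry of `R` in its first two arguments makes the term zero. -/

theorem curvatureCoeff_swap (p : N) (l k i j : Fin n) (z : EuclideanSpace ℝ (Fin n)) :
    curvatureCoeff p l k j i z = -curvatureCoeff p l k i j z := by
  simp only [curvatureCoeff, Finset.sum_sub_distrib]
  ring

theorem components_smul (p : N) {q : N} (c : ℝ) (v : TangentSpace (𝓡 n) q) :
    components p (c • v) = c • components p v :=
  map_smul (mvfderiv (𝓡 n) (extChartAt (𝓡 n) p) q) c v

/-- The curvature operator `R(u, v)` vanishes when `v` is a multiple of `u`. -/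
theorem curvature_smul_right {y : N} (c : ℝ) (u w : TangentSpace (𝓡 n) y) :
    curvature u (c • u) w = 0 := by
  refine Finset.sum_eq_zero fun l _ ↦ ?_
  suffices h : (∑ i, ∑ j, ∑ k, curvatureCoeff y l k i j (extChartAt (𝓡 n) y y) *
      components y u i * components y (c • u) j * components y w k) = 0 by
    rw [h, zero_smul]
  -- Exchanging `i` and `j` fixes the symmetric factor `c * u_i * u_j` and negates the coefficient,
  -- so the sum equals its own negative.
  refine self_eq_neg.mp ?_
  conv_lhs => rw [Finset.sum_comm]
  simp only [← Finset.sum_neg_distrib]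
  refine Finset.sum_congr rfl fun i _ ↦ Finset.sum_congr rfl fun j _ ↦
    Finset.sum_congr rfl fun k _ ↦ ?_
  rw [curvatureCoeff_swap, components_smul, PiLp.smul_apply, PiLp.smul_apply, smul_eq_mul,
    smul_eq_mul]
  ring

/-- Nonpositive sectional curvature bounds `⟨R(u, v) v, u⟩` for all `u` and `v`, including the
linearly dependent pairs. -/
theorem HasNonposCurvature.inner_curvature_nonpos (hN : HasNonposCurvature n N) {y : N}
    (u v : TangentSpace (𝓡 n) y) : inner ℝ (curvature u v v) u ≤ 0 := by
  by_cases huv : LinearIndependent ℝ ![u, v]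
  · have hK := hN y u v huv
    have hne := (LinearIndependent.pair_iff' (huv.ne_zero 0)).mp huv
    -- Strict Cauchy-Schwarz: equality would make `v` a multiple of `u`.
    have hlt : |inner ℝ u v| < ‖u‖ * ‖v‖ := by
      refine lt_of_le_of_ne (abs_real_inner_le_norm u v) fun h ↦ ?_
      obtain ⟨c, hc⟩ := (norm_inner_eq_norm_iff (𝕜 := ℝ) (huv.ne_zero 0) (huv.ne_zero 1)).mp h
      exact hne c hc.2.symm
    have hpos : 0 < ‖u‖ ^ 2 * ‖v‖ ^ 2 - (inner ℝ u v) ^ 2 := by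
      rw [← mul_pow, sub_pos]
      exact sq_lt_sq.mpr (hlt.trans_le (le_abs_self _))
    by_contra! h
    exact hK.not_gt (div_pos h hpos)
  -- Dependence gives `v = c • u` only when `u ≠ 0`.
  · by_cases hu : u = 0
    · rw [hu, inner_zero_right]
    · rw [LinearIndependent.pair_iff' hu] at huv
      push Not at huv
      obtain ⟨c, rfl⟩ := huv
      rw [curvature_smul_right, inner_zero_left]

end Curvature

section Maps

variable {k m n : ℕ}
  {M : Type*} [TopologicalSpace M] [ChartedSpace (EuclideanSpace ℝ (Fin k)) M]
  [IsManifold (𝓡 k) ∞ M] [RiemannianBundle (fun x : M ↦ TangentSpace (𝓡 k) x)]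
  {N : Type*} [TopologicalSpace N] [ChartedSpace (EuclideanSpace ℝ (Fin n)) N]
  [IsManifold (𝓡 n) ∞ N] [RiemannianBundle (fun y : N ↦ TangentSpace (𝓡 n) y)]

/-- The estimate is made term by term, so it does not depend on which vectors `e_i` are summed over.
-/
theorem HasNonposCurvature.indexDensity_nonneg (hN : HasNonposCurvature n N)
    (H : Subbundle k M m) (f : M → N) (V : (x : M) → TangentSpace (𝓡 n) (f x)) (x : M) :
    0 ≤ indexDensity H f V x :=
  sub_nonneg.mpr <| (Finset.sum_nonpos fun _ _ ↦ hN.inner_curvature_nonpos _ _).trans <|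
    add_nonneg (sq_nonneg _) <| Finset.sum_nonneg fun _ _ ↦ real_inner_self_nonneg

end Maps

end ExpSubelliptic

theorem mainTheorem3 {m d n : ℕ}
    {M : Type*} [TopologicalSpace M] [T2Space M] [CompactSpace M] [ConnectedSpace M]
    [MeasurableSpace M] [BorelSpace M]
    [ChartedSpace (EuclideanSpace ℝ (Fin (m + d))) M] [IsManifold (𝓡 (m + d)) ∞ M]
    [RiemannianBundle (fun x : M ↦ TangentSpace (𝓡 (m + d)) x)]
    [IsContMDiffRiemannianBundle (𝓡 (m + d)) ∞ (EuclideanSpace ℝ (Fin (m + d)))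
      (fun x : M ↦ TangentSpace (𝓡 (m + d)) x)]
    (H : ExpSubelliptic.Subbundle (m + d) M m)
    {N : Type*} [TopologicalSpace N] [T2Space N] [SecondCountableTopology N]
    [ChartedSpace (EuclideanSpace ℝ (Fin n)) N] [IsManifold (𝓡 n) ∞ N]
    [RiemannianBundle (fun y : N ↦ TangentSpace (𝓡 n) y)]
    [IsContMDiffRiemannianBundle (𝓡 n) ∞ (EuclideanSpace ℝ (Fin n))
      (fun y : N ↦ TangentSpace (𝓡 n) y)]
    (hN : ExpSubelliptic.HasNonposCurvature n N)
    (f : M → N) (hf : ExpSubelliptic.IsExpSubellipticHarmonic (n := n) H f) :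
    ExpSubelliptic.IsStable (n := n) H f :=
  -- No integrability has to be checked: the Bochner integral of a non-integrable function is `0`.
  fun V _ _ ↦ integral_nonneg fun x ↦
    mul_nonneg (Real.exp_nonneg _) (hN.indexDensity_nonneg H f V x)
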